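/- Let $B_{n,p}$ denote the random bipartite graph whose parts $X$ and $Y$ are two disjoint copies of $\{1,\dots,n\}$ and in which each of the $n^2$ pairs $xy$ with $x\in X$, $y\in Y$ is an edge independently with probability $p$. Let $p=p(n)$ satisfy $\frac{\log^{10}n}{n}\le p\le\frac12$ for all sufficiently large $n$ (where $\log$ is the natural logarithm and $\log^k n=(\log n)^k$), and let $B=B_{n,p}$. Then, with probability tending to $1$ as $n\to\infty$, the following holds: for every set $E\subseteq E(B)$ of edges with $|E|\le\sqrt{np}\,\log n$, the graph $B\setminus E$, obtained from $B$ by deleting the edges in $E$, contains a spanning subgraph that is $d$-regular for $d=\lfloor r\rfloor$ and also one that is $d$-regular for $d=\lceil r\rceil$, where $r=\left(1-\frac{2}{\log^2 n}\right)np$. -/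

import Mathlib

open MeasureTheory ProbabilityTheory Filter Topology

/-- The law of the binomial random balanced bipartite graph `B_{n,p}`: the parts are two disjoint
copies `X = Sum.inl '' univ` and `Y = Sum.inr '' univ` of `Fin n`, each of the `n ^ 2` pairs `xy`
with `x ∈ X` and `y ∈ Y` is an edge with probability `p`, independently, and there are no other
edges. -/
noncomputable def bipartiteBinomialRandom (n : ℕ) (p : unitInterval) :
    Measure (SimpleGraph (Fin n ⊕ Fin n)) :=
  (setBernoulli (completeBipartiteGraph (Fin n) (Fin n)).edgeSet p).comap SimpleGraph.edgeSet

/-- It is a probability measure. -/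
instance bipartiteBinomialRandom.instIsProbabilityMeasure (n : ℕ) (p : unitInterval) :
    IsProbabilityMeasure (bipartiteBinomialRandom n p) := by
  refine SimpleGraph.measurableEmbedding_edgeSet.isProbabilityMeasure_comap ?_
  filter_upwards [setBernoulli_ae_subset] with s hs
  exact ⟨SimpleGraph.fromEdgeSet s, by
    rw [SimpleGraph.edgeSet_fromEdgeSet]
    refine sdiff_eq_left.2 (Set.disjoint_left.2 fun e he hd => ?_)
    exact (SimpleGraph.edgeSet_subset_compl_diagSet _ (hs he)) hd⟩

open scoped Classical in
/-- `G` contains a `d`-regular spanning subgraph. -/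
def HasSpanningRegularSubgraph {V : Type*} [Fintype V] (G : SimpleGraph V) (d : ℕ) : Prop :=
  ∃ H : SimpleGraph V, H ≤ G ∧ H.IsRegularOfDegree d

/-- The target degree `(1 - 2 / log² n) n p`, a real number. -/
noncomputable def targetDegree (n : ℕ) (p : ℝ) : ℝ :=
  (1 - 2 / Real.log n ^ 2) * (n * p)

/-- After the deletion of any set `E` of at most `√(np) log n` edges, `B` still contains a spanning
subgraph that is regular of degree `targetDegree n p`, rounded down or up to an integer. -/
def RobustlyRegular (n : ℕ) (p : ℝ) (B : SimpleGraph (Fin n ⊕ Fin n)) : Prop :=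
  ∀ E : Finset (Sym2 (Fin n ⊕ Fin n)), (E : Set (Sym2 (Fin n ⊕ Fin n))) ⊆ B.edgeSet →
    (E.card : ℝ) ≤ √(n * p) * Real.log n →
      HasSpanningRegularSubgraph (B.deleteEdges E) ⌊targetDegree n p⌋₊ ∧
      HasSpanningRegularSubgraph (B.deleteEdges E) ⌈targetDegree n p⌉₊

/-! By Ore–Ryser, a bipartite graph with parts of size `n` has a `d`-factor once e(S,T) ≥
d(|S|+|T|-n) for all S, T; only |S|+|T| > n matters. This follows from Hall's theorem applied to
`factorRel`: each vertex gets `d` slots and each edge appears on both sides. In a perfect matching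
an edge paired with its own copy is discarded, and any other edge takes one slot at each end
(`exists_factor_of_oreRyser`).

Write L = log n and k = |S|+|T|-n. Then |S||T| ≥ nk, so Chernoff with ε = 1/L² leaves (1-1/L²)npk
edges between S and T, while (1-2/L²)npk are needed. The surplus npk/L² absorbs the deleted edges
and the rounding because np ≥ L^10 (`hasSpanningRegularSubgraph_deleteEdges`). A union bound over
(S,T) with weights summing to O(1/n) finishes (`bipartiteBinomialRandom_not_isLowerUniform`). -/

/-! ### Degree-constrained factors from Hall's theorem -/

/-- The incidence relation of the bipartite graph to which Hall's theorem is applied in order to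
find a `d`-factor of the bipartite graph with edge set `M`. -/
def factorRel {α β : Type*} (M : Finset (α × β)) (d : ℕ) :
    (α × Fin d) ⊕ M → (β × Fin d) ⊕ M → Prop
  | .inl _, .inl _ => False
  | .inl x, .inr e => e.1.1 = x.1
  | .inr e, .inl y => e.1.2 = y.1
  | .inr e, .inr e' => e = e'

section Factor

variable {α β : Type*} [Fintype β] [DecidableEq α] [DecidableEq β]

open scoped Classical in
/-- Hall's condition holds for `factorRel` under the Ore–Ryser condition. -/
lemma factorRel_hall {M : Finset (α × β)} {d : ℕ}
    (h : ∀ (S : Finset α) (T : Finset β), d * (S.card + T.card) ≤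
      (M.filter fun e => e.1 ∈ S ∧ e.2 ∈ T).card + d * Fintype.card β)
    (A : Finset ((α × Fin d) ⊕ M)) :
    A.card ≤ (Finset.univ.filter fun b => ∃ a ∈ A, factorRel M d a b).card := by
  set S : Finset α := A.toLeft.image Prod.fst with hS
  set F : Finset M := A.toRight with hF
  -- T is the set of vertices missed by F, so edges from S to T lie outside F and enlarge the
  -- neighbourhood beyond F itself.
  set T : Finset β := (F.image fun e => e.1.2)ᶜ with hT
  have hA : A.card ≤ d * S.card + F.card := by
    rw [← Finset.card_toLeft_add_card_toRight (u := A)]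
    gcongr
    calc A.toLeft.card ≤ (S ×ˢ (Finset.univ : Finset (Fin d))).card := by
          refine Finset.card_le_card fun x hx => ?_
          simp only [Finset.mem_product, Finset.mem_univ, and_true]
          exact Finset.mem_image_of_mem _ hx
      _ = d * S.card := by simp [mul_comm]
  set N := Finset.univ.filter fun b => ∃ a ∈ A, factorRel M d a b with hN
  have hl : d * (Fintype.card β - T.card) ≤ N.toLeft.card := by
    calc d * (Fintype.card β - T.card) = (Tᶜ ×ˢ (Finset.univ : Finset (Fin d))).card := by
          rw [Finset.card_product, Finset.card_compl T, Finset.card_univ, Fintype.card_fin, mul_comm]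
      _ ≤ _ := by
          refine Finset.card_le_card fun y hy => ?_
          simp only [hT, compl_compl, Finset.mem_product, Finset.mem_image, Finset.mem_univ,
            and_true] at hy
          obtain ⟨e, he, hey⟩ := hy
          rw [Finset.mem_toLeft, hN, Finset.mem_filter]
          exact ⟨Finset.mem_univ _, .inr e, Finset.mem_toRight.1 he, hey⟩
  have hr : F.card + (M.filter fun e => e.1 ∈ S ∧ e.2 ∈ T).card ≤ N.toRight.card := by
    have e1 : (M.filter fun e => e.1 ∈ S ∧ e.2 ∈ T).card =
        ((Finset.univ : Finset M).filter fun e => e.1.1 ∈ S ∧ e.1.2 ∈ T).card := by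
      rw [← Finset.card_map (Function.Embedding.subtype (· ∈ M))]
      congr 1
      ext e
      simp
      tauto
    rw [e1, ← Finset.card_union_of_disjoint]
    · refine Finset.card_le_card fun e he => ?_
      rw [Finset.mem_toRight, hN, Finset.mem_filter]
      refine ⟨Finset.mem_univ _, ?_⟩
      rcases Finset.mem_union.1 he with he | he
      · exact ⟨.inr e, Finset.mem_toRight.1 he, rfl⟩
      · obtain ⟨x, hx, hxe⟩ := Finset.mem_image.1 (Finset.mem_filter.1 he).2.1
        exact ⟨.inl x, Finset.mem_toLeft.1 hx, hxe.symm⟩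
    · refine Finset.disjoint_left.2 fun e he he' => ?_
      have := (Finset.mem_filter.1 he').2.2
      rw [hT, Finset.mem_compl] at this
      exact this (Finset.mem_image_of_mem _ he)
  have hNc := Finset.card_toLeft_add_card_toRight (u := N)
  have hTc : T.card ≤ Fintype.card β := Finset.card_le_univ T
  have := h S T
  obtain ⟨c, hc⟩ := Nat.exists_eq_add_of_le hTc
  rw [hc] at hl this
  simp only [Nat.add_sub_cancel_left] at hl
  nlinarith

variable [Fintype α]

/-- The Ore–Ryser theorem for balanced bipartite graphs. -/
theorem exists_factor_of_oreRyser (hcard : Fintype.card α = Fintype.card β)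
    {M : Finset (α × β)} {d : ℕ}
    (h : ∀ (S : Finset α) (T : Finset β), d * (S.card + T.card) ≤
      (M.filter fun e => e.1 ∈ S ∧ e.2 ∈ T).card + d * Fintype.card β) :
    ∃ M' ⊆ M, (∀ x, (M'.filter fun e => e.1 = x).card = d) ∧
      ∀ y, (M'.filter fun e => e.2 = y).card = d := by
  classical
  obtain ⟨f, hf, hfr⟩ :=
    (Fintype.all_card_le_filter_rel_iff_exists_injective (factorRel M d)).1 fun A => by
      convert factorRel_hall h A
  have hbij : f.Bijective := by
    rw [Fintype.bijective_iff_injective_and_card]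
    exact ⟨hf, by simp [hcard]⟩
  have hx (x : α × Fin d) : ∃ e : M, f (.inl x) = .inr e ∧ e.1.1 = x.1 := by
    have := hfr (.inl x)
    rcases hfx : f (.inl x) with y | e
    · rw [hfx] at this
      exact this.elim
    · rw [hfx] at this
      exact ⟨e, rfl, this⟩
  have hy (y : β × Fin d) : ∃ e : M, f (.inr e) = .inl y ∧ e.1.2 = y.1 := by
    obtain ⟨a, ha⟩ := hbij.2 (.inl y)
    have := hfr a
    rw [ha] at this
    rcases a with x | e
    · exact this.elim
    · exact ⟨e, ha, this⟩
  choose gx hgx hgx' using hx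
  choose gy hgy hgy' using hy
  have hgx_inj : gx.Injective := fun a b hab => by
    have := hgx a
    rw [hab, ← hgx b] at this
    exact Sum.inl_injective (hf this)
  have hgy_inj : gy.Injective := fun a b hab => by
    have := hgy a
    rw [hab, hgy b] at this
    exact (Sum.inl_injective this).symm
  -- An edge not paired with its own copy is matched to a slot on both sides, so `gx` and `gy`
  -- enumerate the same edge set, which is the factor.
  have hrange (e : M) : (∃ x, gx x = e) ↔ ∃ y, gy y = e := by
    constructor
    · rintro ⟨x, rfl⟩
      have hr := hfr (.inr (gx x))
      rcases hfe : f (.inr (gx x)) with y | e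
      · exact ⟨y, Sum.inr_injective (hf ((hgy y).trans hfe.symm))⟩
      · rw [hfe] at hr
        have hr : gx x = e := hr
        rw [← hr, ← hgx x] at hfe
        exact absurd (hf hfe) (by simp)
    · rintro ⟨y, rfl⟩
      obtain ⟨a, ha⟩ := hbij.2 (.inr (gy y))
      rcases a with x | e
      · exact ⟨x, Sum.inr_injective ((hgx x).symm.trans ha)⟩
      · have hr := hfr (.inr e)
        rw [ha] at hr
        have hr : e = gy y := hr
        rw [hr, hgy y] at ha
        exact absurd ha (by simp)
  refine ⟨Finset.univ.image fun x => (gx x).1, ?_, fun x => ?_, fun y => ?_⟩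
  · intro e he
    obtain ⟨x, -, rfl⟩ := Finset.mem_image.1 he
    exact (gx x).2
  · calc _ = ((Finset.univ : Finset (Fin d)).image fun i => (gx (x, i)).1).card := by
          congr 1
          ext e
          simp only [Finset.mem_filter, Finset.mem_image, Finset.mem_univ, true_and]
          constructor
          · rintro ⟨⟨⟨x', i⟩, rfl⟩, rfl⟩
            exact ⟨i, by rw [hgx']⟩
          · rintro ⟨i, rfl⟩
            exact ⟨⟨_, rfl⟩, hgx' _⟩
      _ = d := by
          rw [Finset.card_image_of_injective _ fun i j hij => by
            simpa using hgx_inj (Subtype.ext hij)]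
          simp
  · calc _ = ((Finset.univ : Finset (Fin d)).image fun i => (gy (y, i)).1).card := by
          congr 1
          ext e
          simp only [Finset.mem_filter, Finset.mem_image, Finset.mem_univ, true_and]
          constructor
          · rintro ⟨⟨x, rfl⟩, rfl⟩
            obtain ⟨⟨y', i⟩, hy'⟩ := (hrange (gx x)).1 ⟨x, rfl⟩
            refine ⟨i, ?_⟩
            rw [← hy', hgy']
          · rintro ⟨i, rfl⟩
            obtain ⟨x, hx⟩ := (hrange (gy (y, i))).2 ⟨_, rfl⟩
            exact ⟨⟨x, by rw [hx]⟩, hgy' _⟩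
      _ = d := by
          rw [Finset.card_image_of_injective _ fun i j hij => by
            simpa using hgy_inj (Subtype.ext hij)]
          simp

open scoped Classical in
/-- A graph on `α ⊕ β` whose cross edges satisfy the Ore–Ryser condition has a `d`-factor. -/
theorem hasSpanningRegularSubgraph_of_oreRyser (hcard : Fintype.card α = Fintype.card β)
    {G : SimpleGraph (α ⊕ β)} {d : ℕ}
    (h : ∀ (S : Finset α) (T : Finset β), d * (S.card + T.card) ≤
      ((S ×ˢ T).filter fun e => G.Adj (.inl e.1) (.inr e.2)).card + d * Fintype.card β) :
    HasSpanningRegularSubgraph G d := by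
  obtain ⟨M, hM, hx, hy⟩ := exists_factor_of_oreRyser hcard
    (M := Finset.univ.filter fun e : α × β => G.Adj (.inl e.1) (.inr e.2)) (d := d) fun S T => by
      convert h S T using 3
      ext e
      simp
      tauto
  let H : SimpleGraph (α ⊕ β) :=
    SimpleGraph.fromEdgeSet {s | ∃ e ∈ M, s = s(.inl e.1, .inr e.2)}
  have hadj (x : α) (y : β) : H.Adj (.inl x) (.inr y) ↔ (x, y) ∈ M := by
    simp [H]
  have hll (x x' : α) : ¬ H.Adj (.inl x) (.inl x') := by simp [H]
  have hrr (y y' : β) : ¬ H.Adj (.inr y) (.inr y') := by simp [H]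
  refine ⟨H, ?_, ?_⟩
  · rintro (x | y) (x' | y') hxy
    · exact (hll _ _ hxy).elim
    · exact (Finset.mem_filter.1 (hM ((hadj _ _).1 hxy))).2
    · exact (Finset.mem_filter.1 (hM ((hadj _ _).1 hxy.symm))).2.symm
    · exact (hrr _ _ hxy).elim
  · rintro (x | y)
    · rw [← hx x, ← SimpleGraph.card_neighborFinset_eq_degree]
      symm
      refine Finset.card_bij (fun e _ => .inr e.2) ?_ ?_ ?_
      · rintro ⟨a, b⟩ he
        obtain ⟨he, rfl⟩ := Finset.mem_filter.1 he
        simpa [hadj] using he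
      · rintro ⟨a, b⟩ he ⟨a', b'⟩ he' hab
        simp_all
      · rintro (a | b) hab
        · exact (hll _ _ (by simpa using hab)).elim
        · exact ⟨(x, b), by simpa [hadj] using hab, rfl⟩
    · rw [← hy y, ← SimpleGraph.card_neighborFinset_eq_degree]
      symm
      refine Finset.card_bij (fun e _ => .inl e.1) ?_ ?_ ?_
      · rintro ⟨a, b⟩ he
        obtain ⟨he, rfl⟩ := Finset.mem_filter.1 he
        simpa [hadj, H.adj_comm (.inr _)] using he
      · rintro ⟨a, b⟩ he ⟨a', b'⟩ he' hab
        simp_all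
      · rintro (a | b) hab
        · exact ⟨(a, y), by simpa [hadj, H.adj_comm (.inr _)] using hab, rfl⟩
        · exact (hrr _ _ (by simpa using hab)).elim

end Factor

/-! ### Chernoff's lower tail bound for random sets -/

lemma integral_bernoulliProp (p : unitInterval) (g : Prop → ℝ) :
    ∫ b, g b ∂((unitInterval.toNNReal p) • Measure.dirac True +
      (unitInterval.toNNReal (unitInterval.symm p)) • Measure.dirac False) =
      p * g True + (1 - p) * g False := by
  rw [integral_add_measure, integral_smul_nnreal_measure, integral_smul_nnreal_measure,
    integral_dirac, integral_dirac]
  · simp [NNReal.smul_def]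
  · exact Integrable.of_finite
  · exact Integrable.of_finite

open scoped Classical in
lemma mgf_setBernoulli {ι : Type*} [Fintype ι] {u : Set ι} (p : unitInterval) {F : Finset ι}
    (hF : (F : Set ι) ⊆ u) (t : ℝ) :
    mgf (fun s : Set ι => ((F.filter (· ∈ s)).card : ℝ)) (setBernoulli u p) t =
      (p * Real.exp t + (1 - p)) ^ F.card := by
  have hm : Measurable fun q : ι → Prop => {i | q i} := MeasurableEquiv.setOfPred.measurable
  rw [mgf, setBernoulli_eq_map, integral_map hm.aemeasurable .of_discrete, Measure.infinitePi_eq_pi]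
  have key (q : ι → Prop) : Real.exp (t * ((F.filter (· ∈ {i | q i})).card : ℝ)) =
      ∏ i, if i ∈ F ∧ q i then Real.exp t else 1 := by
    rw [Finset.prod_ite, Finset.prod_const_one, mul_one, Finset.prod_const, ← Real.exp_nat_mul,
      mul_comm]
    congr 4
    ext i
    simp
  simp_rw [key]
  rw [integral_fintype_prod_eq_prod (f := fun i (b : Prop) => if i ∈ F ∧ b then Real.exp t else 1)]
  calc _ = ∏ i, if i ∈ F then (p * Real.exp t + (1 - p) : ℝ) else 1 := by
        refine Finset.prod_congr rfl fun i _ => ?_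
        by_cases hi : i ∈ F
        · have : (i ∈ u) = True := by simpa using hF hi
          rw [this, integral_bernoulliProp]
          simp [hi]
        · simp only [hi, false_and, if_false]
          rw [integral_const]
          simp
    _ = _ := by simp

open scoped Classical in
/-- Chernoff's bound for the lower tail of the binomial distribution. -/
lemma setBernoulli_lower_tail {ι : Type*} [Fintype ι] {u : Set ι} (p : unitInterval)
    {F : Finset ι} (hF : (F : Set ι) ⊆ u) {ε : ℝ} (hε : 0 ≤ ε) :
    setBernoulli u p {s | ((F.filter (· ∈ s)).card : ℝ) ≤ (1 - ε) * (p * F.card)} ≤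
      ENNReal.ofReal (Real.exp (-(ε ^ 2 * (p * F.card) / 2))) := by
  rw [← ofReal_measureReal]
  refine ENNReal.ofReal_le_ofReal ?_
  refine (measure_le_le_exp_mul_mgf (t := -ε) _ (by linarith) Integrable.of_finite).trans ?_
  rw [mgf_setBernoulli p hF]
  have hp0 := p.2.1
  have hp1 := p.2.2
  -- From e^ε ≥ 1+ε+ε²/2, since (1-ε+ε²/2)(1+ε+ε²/2) = 1+ε⁴/4 ≥ 1.
  have hexp : Real.exp (-ε) ≤ 1 - ε + ε ^ 2 / 2 := by
    have h1 := Real.quadratic_le_exp_of_nonneg hε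
    have h2 : Real.exp (-ε) * Real.exp ε = 1 := by rw [← Real.exp_add]; simp
    have h3 := mul_le_mul_of_nonneg_left h1 (Real.exp_pos (-ε)).le
    rw [h2] at h3
    by_contra! h4
    have h5 := mul_lt_mul_of_pos_right h4 (show 0 < 1 + ε + ε ^ 2 / 2 by positivity)
    nlinarith [sq_nonneg (ε ^ 2)]
  have hb : (p * Real.exp (-ε) + (1 - p) : ℝ) ≤ Real.exp (-(p * (ε - ε ^ 2 / 2))) := by
    have := Real.add_one_le_exp (-(p * (ε - ε ^ 2 / 2)) : ℝ)
    nlinarith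
  have hb0 : (0 : ℝ) ≤ p * Real.exp (-ε) + (1 - p) := by
    have := mul_nonneg hp0 (Real.exp_pos (-ε)).le
    linarith
  calc _ ≤ Real.exp (-(-ε) * ((1 - ε) * (p * F.card))) *
        Real.exp (-(p * (ε - ε ^ 2 / 2))) ^ F.card := by gcongr
    _ = _ := by
        rw [← Real.exp_nat_mul, ← Real.exp_add]
        congr 1
        ring

/-! ### Deterministic step: edge counts give robust regular factors -/

/-- The ordered pair of `x` in the first part and `y` in the second part, as an unordered pair. -/
def crossPair {α β : Type*} : α × β ↪ Sym2 (α ⊕ β) where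
  toFun e := s(.inl e.1, .inr e.2)
  inj' := by
    rintro ⟨a, b⟩ ⟨a', b'⟩ h
    simpa using h

open scoped Classical in
/-- Any two sets of vertices `S ⊆ X`, `T ⊆ Y` of total size more than `n` span more than
`(1 - ε) p |S| |T|` edges of `B`. -/
def IsLowerUniform (n : ℕ) (p ε : ℝ) (B : SimpleGraph (Fin n ⊕ Fin n)) : Prop :=
  ∀ S T : Finset (Fin n), n < S.card + T.card →
    (1 - ε) * (p * (S.card * T.card)) <
      ((S ×ˢ T).filter fun e => B.Adj (.inl e.1) (.inr e.2)).card

open scoped Classical in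
lemma card_filter_adj_le_deleteEdges {n : ℕ} (B : SimpleGraph (Fin n ⊕ Fin n))
    (E : Finset (Sym2 (Fin n ⊕ Fin n))) (S T : Finset (Fin n)) :
    ((S ×ˢ T).filter fun e => B.Adj (.inl e.1) (.inr e.2)).card ≤
      ((S ×ˢ T).filter fun e => (B.deleteEdges E).Adj (.inl e.1) (.inr e.2)).card + E.card := by
  have h1 : ((S ×ˢ T).filter fun e => crossPair e ∈ E).card ≤ E.card := by
    rw [← Finset.card_map crossPair]
    refine Finset.card_le_card fun s hs => ?_
    obtain ⟨e, he, rfl⟩ := Finset.mem_map.1 hs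
    exact (Finset.mem_filter.1 he).2
  refine le_trans ?_ (Nat.add_le_add_left h1 _)
  refine le_trans (Finset.card_le_card ?_) (Finset.card_union_le _ _)
  intro e he
  simp only [Finset.mem_union, Finset.mem_filter, SimpleGraph.deleteEdges_adj] at he ⊢
  by_cases hE : crossPair e ∈ E
  · exact .inr ⟨he.1, hE⟩
  · exact .inl ⟨he.1, he.2, hE⟩

/-- Of the 2/log² n lost in the target degree, one half pays for the deviation in edge counts, the
other for `E` and the rounding. The slack of 1 in the bound on `d` covers floor and ceiling at once.
-/
lemma hasSpanningRegularSubgraph_deleteEdges {n : ℕ} {p : ℝ} {B : SimpleGraph (Fin n ⊕ Fin n)}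
    (hlog : 2 ≤ Real.log n) (hp : Real.log n ^ 10 ≤ n * p)
    (hB : IsLowerUniform n p (1 / Real.log n ^ 2) B) {E : Finset (Sym2 (Fin n ⊕ Fin n))}
    (hE : (E.card : ℝ) ≤ √(n * p) * Real.log n) {d : ℕ} (hd : (d : ℝ) ≤ targetDegree n p + 1) :
    HasSpanningRegularSubgraph (B.deleteEdges E) d := by
  classical
  refine hasSpanningRegularSubgraph_of_oreRyser rfl fun S T => ?_
  rw [Fintype.card_fin]
  rcases le_or_gt (S.card + T.card) n with hST | hST
  · exact (Nat.mul_le_mul_left d hST).trans (Nat.le_add_left _ _)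
  have hS : S.card ≤ n := by simpa using Finset.card_le_univ S
  have hT : T.card ≤ n := by simpa using Finset.card_le_univ T
  have hcount := hB S T hST
  have hdel := card_filter_adj_le_deleteEdges B E S T
  have hdel' : (((S ×ˢ T).filter fun e => B.Adj (.inl e.1) (.inr e.2)).card : ℝ) ≤
      ((S ×ˢ T).filter fun e => (B.deleteEdges E).Adj (.inl e.1) (.inr e.2)).card + E.card := by
    exact_mod_cast hdel
  suffices h : (d : ℝ) * (S.card + T.card - n) ≤
      ((S ×ˢ T).filter fun e => (B.deleteEdges E).Adj (.inl e.1) (.inr e.2)).card by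
    have : (d : ℝ) * (S.card + T.card) ≤
      ((S ×ˢ T).filter fun e => (B.deleteEdges E).Adj (.inl e.1) (.inr e.2)).card + d * n := by
      linarith
    have hnat : d * (S.card + T.card) ≤
      ((S ×ˢ T).filter fun e => (B.deleteEdges E).Adj (.inl e.1) (.inr e.2)).card + d * n := by
      exact_mod_cast this
    convert hnat
  refine le_trans ?_ (by linarith :
    (1 - 1 / Real.log n ^ 2) * (p * (S.card * T.card)) - √(n * p) * Real.log n ≤ _)
  set L := Real.log n
  have hnp : 0 ≤ n * p := (by positivity : (0 : ℝ) ≤ L ^ 10).trans hp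
  have hn : (0 : ℝ) < n := by
    rcases Nat.eq_zero_or_pos n with rfl | h
    · omega
    · exact_mod_cast h
  have hp0 : 0 ≤ p := nonneg_of_mul_nonneg_right hnp hn
  set w := √(n * p) with hw
  have hw2 : n * p = w ^ 2 := (Real.sq_sqrt hnp).symm
  have hw5 : L ^ 5 ≤ w := by
    rw [hw]
    refine Real.le_sqrt_of_sq_le ?_
    rw [← pow_mul]
    exact hp
  set k : ℝ := S.card + T.card - n with hk
  have hk1 : 1 ≤ k := by
    have : (n : ℝ) + 1 ≤ S.card + T.card := by exact_mod_cast hST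
    linarith
  -- Equivalent to (n-|S|)(n-|T|) ≥ 0.
  have hprod : n * k ≤ (S.card * T.card : ℝ) := by
    have h1 : (0 : ℝ) ≤ n - S.card := sub_nonneg.2 (by exact_mod_cast hS)
    have h2 : (0 : ℝ) ≤ n - T.card := sub_nonneg.2 (by exact_mod_cast hT)
    nlinarith [mul_nonneg h1 h2]
  have hε : 1 / L ^ 2 ≤ 1 := by
    rw [div_le_one (by positivity)]
    nlinarith
  have h1 : (1 - 1 / L ^ 2) * (w ^ 2 * k) ≤ (1 - 1 / L ^ 2) * (p * (S.card * T.card)) := by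
    refine mul_le_mul_of_nonneg_left ?_ (by linarith)
    rw [← hw2]
    calc n * p * k = p * (n * k) := by ring
      _ ≤ _ := mul_le_mul_of_nonneg_left hprod hp0
  have h2 : d * k ≤ ((1 - 2 / L ^ 2) * w ^ 2 + 1) * k := by
    refine mul_le_mul_of_nonneg_right ?_ (by linarith)
    rw [← hw2]
    exact hd
  have hw1 : 1 ≤ w := (one_le_pow₀ (by linarith)).trans hw5
  -- Deletions cost wL and rounding at most 1 per unit of k; w ≥ L⁵ and L ≥ 2 make both fit.
  have h3 : w * L + 1 ≤ w ^ 2 / L ^ 2 := by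
    rw [le_div_iff₀ (by positivity)]
    calc (w * L + 1) * L ^ 2 ≤ (w * L + w * L) * L ^ 2 := by
          gcongr
          nlinarith
      _ = w * (2 * L ^ 3) := by ring
      _ ≤ w * (L ^ 2 * L ^ 3) := by gcongr; nlinarith
      _ = w * L ^ 5 := by ring
      _ ≤ w * w := by gcongr
      _ = w ^ 2 := by ring
  have h4 : (w * L + 1) * k ≤ w ^ 2 / L ^ 2 * k := mul_le_mul_of_nonneg_right h3 (by linarith)
  have h5 : w * L * 1 ≤ w * L * k := mul_le_mul_of_nonneg_left hk1 (by positivity)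
  have e1 : (1 - 1 / L ^ 2) * (w ^ 2 * k) - ((1 - 2 / L ^ 2) * w ^ 2 + 1) * k =
      w ^ 2 / L ^ 2 * k - k := by ring
  linarith

lemma IsLowerUniform.robustlyRegular {n : ℕ} {p : ℝ} {B : SimpleGraph (Fin n ⊕ Fin n)}
    (hB : IsLowerUniform n p (1 / Real.log n ^ 2) B) (hlog : 2 ≤ Real.log n)
    (hp : Real.log n ^ 10 ≤ n * p) : RobustlyRegular n p B := by
  intro E _ hE
  -- The natural-number floor of a negative real is 0, which would exceed it.
  have h0 : 0 ≤ targetDegree n p := by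
    refine mul_nonneg ?_ ((by positivity : (0 : ℝ) ≤ Real.log n ^ 10).trans hp)
    rw [sub_nonneg, div_le_one (by positivity)]
    nlinarith
  exact ⟨hasSpanningRegularSubgraph_deleteEdges hlog hp hB hE
      ((Nat.floor_le h0).trans (by linarith)),
    hasSpanningRegularSubgraph_deleteEdges hlog hp hB hE (Nat.ceil_lt_add_one h0).le⟩

/-! ### Union bound over pairs of vertex sets -/

/-- The union bound's weight of a pair of sets dominates the Chernoff bound. -/
lemma exp_neg_le_weight {n s t : ℕ} {p : ℝ} (hlog : 2 ≤ Real.log n)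
    (hp : Real.log n ^ 10 ≤ n * p) (hs : s ≤ n) (hst : n < s + t) (hts : t ≤ s) :
    Real.exp (-((1 / Real.log n ^ 2) ^ 2 * (p * (s * t)) / 2)) ≤
      (n : ℝ)⁻¹ * ((n : ℝ)⁻¹ ^ t * (n : ℝ)⁻¹ ^ (n - s)) := by
  have hn : (0 : ℝ) < n := by
    rcases Nat.eq_zero_or_pos n with rfl | h
    · omega
    · exact_mod_cast h
  have ht : (1 : ℝ) ≤ t := by exact_mod_cast (by omega : 1 ≤ t)
  have hs2 : (n : ℝ) ≤ 2 * s := by exact_mod_cast (by omega : n ≤ 2 * s)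
  have hr : (n : ℝ)⁻¹ * ((n : ℝ)⁻¹ ^ t * (n : ℝ)⁻¹ ^ (n - s)) =
      Real.exp (-(Real.log n * (1 + t + (n - s : ℕ)))) := by
    rw [← pow_add, ← pow_succ', ← Real.exp_log (inv_pos.2 hn), ← Real.exp_nat_mul,
      Real.log_inv]
    push_cast
    congr 1
    ring
  rw [hr, Real.exp_le_exp, neg_le_neg_iff]
  have hns : ((n - s : ℕ) : ℝ) ≤ t := by exact_mod_cast (by omega : n - s ≤ t)
  set L := Real.log n
  have hpn : 0 ≤ n * p := (by positivity : (0 : ℝ) ≤ L ^ 10).trans hp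
  have hp0 : 0 ≤ p := nonneg_of_mul_nonneg_right hpn hn
  -- Since s ≥ n/2, the Chernoff exponent is at least L⁶t/4 ≥ 8Lt, more than the 3Lt required.
  calc L * (1 + t + (n - s : ℕ)) ≤ L * (t + t + t) := by gcongr
    _ ≤ L ^ 6 * t / 4 := by
        have : (2 : ℝ) ^ 5 ≤ L ^ 5 := by gcongr
        have h2 : 0 ≤ L * t := by positivity
        nlinarith [mul_le_mul_of_nonneg_left this h2]
    _ = (1 / L ^ 2) ^ 2 * (L ^ 10 * t) / 4 := by field_simp
    _ ≤ (1 / L ^ 2) ^ 2 * (n * p * t) / 4 := by gcongr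
    _ ≤ (1 / L ^ 2) ^ 2 * (2 * s * p * t) / 4 := by gcongr
    _ = _ := by ring

open scoped Classical in
lemma bipartiteBinomialRandom_lower_tail {n : ℕ} (p : unitInterval) {ε : ℝ} (hε : 0 ≤ ε)
    (S T : Finset (Fin n)) :
    bipartiteBinomialRandom n p
      {B | (((S ×ˢ T).filter fun e => B.Adj (.inl e.1) (.inr e.2)).card : ℝ) ≤
        (1 - ε) * (p * (S.card * T.card))} ≤
      ENNReal.ofReal (Real.exp (-(ε ^ 2 * (p * (S.card * T.card)) / 2))) := by
  have hF : (((S ×ˢ T).map crossPair : Finset _) : Set (Sym2 (Fin n ⊕ Fin n))) ⊆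
      (completeBipartiteGraph (Fin n) (Fin n)).edgeSet := by
    intro s hs
    obtain ⟨e, -, rfl⟩ := Finset.mem_map.1 (Finset.mem_coe.1 hs)
    change s(Sum.inl e.1, Sum.inr e.2) ∈ _
    simp
  have := setBernoulli_lower_tail p hF hε
  rw [Finset.card_map, Finset.card_product, Nat.cast_mul] at this
  refine le_trans ?_ this
  rw [bipartiteBinomialRandom, SimpleGraph.measurableEmbedding_edgeSet.comap_apply]
  refine measure_mono ?_
  rintro _ ⟨B, hB, rfl⟩
  have hcard : (((S ×ˢ T).map crossPair).filter (· ∈ B.edgeSet)).card =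
      ((S ×ˢ T).filter fun e => B.Adj (.inl e.1) (.inr e.2)).card := by
    rw [Finset.filter_map, Finset.card_map]
    congr
  refine le_trans (le_of_eq ?_) (Set.mem_ofPred_eq ▸ hB)
  convert congrArg (Nat.cast (R := ℝ)) hcard

lemma sum_finset_pow_card {n : ℕ} (q : ℝ) :
    ∑ S : Finset (Fin n), q ^ S.card = (1 + q) ^ n := by
  have := Fin.sum_pow_mul_eq_add_pow (n := n) q 1
  simpa [add_comm] using this

lemma sum_finset_pow_sub_card {n : ℕ} (q : ℝ) :
    ∑ S : Finset (Fin n), q ^ (n - S.card) = (1 + q) ^ n := by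
  simpa using Fin.sum_pow_mul_eq_add_pow (n := n) 1 q

lemma bipartiteBinomialRandom_not_isLowerUniform {n : ℕ} (p : unitInterval)
    (hlog : 2 ≤ Real.log n) (hp : Real.log n ^ 10 ≤ n * (p : ℝ)) :
    bipartiteBinomialRandom n p {B | ¬ IsLowerUniform n p (1 / Real.log n ^ 2) B} ≤
      ENNReal.ofReal (2 * Real.exp 2 * (n : ℝ)⁻¹) := by
  classical
  set q := (n : ℝ)⁻¹ with hq
  have hq0 : 0 ≤ q := by positivity
  -- One summand for each ordering of |S| and |T|. The larger set is weighted by its complement, so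
  -- each summand factorizes and sums to q(1+q)^(2n) ≤ e²/n.
  let w (S T : Finset (Fin n)) : ℝ :=
    q * (q ^ T.card * q ^ (n - S.card)) + q * (q ^ S.card * q ^ (n - T.card))
  have hw (S T : Finset (Fin n)) : 0 ≤ w S T := by positivity
  let bad (S T : Finset (Fin n)) : Set (SimpleGraph (Fin n ⊕ Fin n)) :=
    {B | n < S.card + T.card ∧
      (((S ×ˢ T).filter fun e => B.Adj (.inl e.1) (.inr e.2)).card : ℝ) ≤
        (1 - 1 / Real.log n ^ 2) * (p * (S.card * T.card))}
  have hbad (S T : Finset (Fin n)) :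
      bipartiteBinomialRandom n p (bad S T) ≤ ENNReal.ofReal (w S T) := by
    by_cases hST : n < S.card + T.card
    · refine (measure_mono fun B hB => hB.2).trans
        ((bipartiteBinomialRandom_lower_tail p (by positivity) S T).trans
          (ENNReal.ofReal_le_ofReal ?_))
      have hS : S.card ≤ n := by simpa using Finset.card_le_univ S
      have hT : T.card ≤ n := by simpa using Finset.card_le_univ T
      rcases le_total T.card S.card with h | h
      · refine (exp_neg_le_weight hlog hp hS hST h).trans (le_add_of_nonneg_right ?_)
        positivity
      · rw [mul_comm (S.card : ℝ)]
        refine (exp_neg_le_weight hlog hp hT (by omega) h).trans (le_add_of_nonneg_left ?_)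
        positivity
    · have : bad S T = ∅ := Set.eq_empty_of_forall_notMem fun B hB => hST hB.1
      simp [this]
  have hsub : {B | ¬ IsLowerUniform n p (1 / Real.log n ^ 2) B} ⊆
      ⋃ S ∈ (Finset.univ : Finset (Finset (Fin n))),
        ⋃ T ∈ (Finset.univ : Finset (Finset (Fin n))), bad S T := by
    intro B hB
    simp only [IsLowerUniform, Set.mem_ofPred_eq, not_forall, not_lt] at hB
    obtain ⟨S, T, hST, h⟩ := hB
    simp only [Finset.mem_univ, Set.iUnion_true, Set.mem_iUnion]
    exact ⟨S, T, hST, h⟩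
  have hsum : ∑ S : Finset (Fin n), ∑ T : Finset (Fin n), w S T ≤ 2 * Real.exp 2 * q := by
    have e1 : ∑ S : Finset (Fin n), ∑ T : Finset (Fin n), w S T =
        2 * q * ((1 + q) ^ n * (1 + q) ^ n) := by
      simp only [w, Finset.sum_add_distrib, ← Finset.mul_sum, ← Finset.sum_mul,
        sum_finset_pow_card, sum_finset_pow_sub_card]
      ring
    have e2 : (1 + q) ^ n ≤ Real.exp 1 := by
      calc (1 + q) ^ n ≤ Real.exp q ^ n := by
            gcongr
            rw [add_comm]
            exact Real.add_one_le_exp q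
        _ = Real.exp (n * q) := by rw [Real.exp_nat_mul]
        _ ≤ Real.exp 1 := Real.exp_le_exp.2 (mul_inv_le_one)
    rw [e1]
    calc 2 * q * ((1 + q) ^ n * (1 + q) ^ n) ≤ 2 * q * (Real.exp 1 * Real.exp 1) := by gcongr
      _ = 2 * Real.exp 2 * q := by
          rw [← Real.exp_add]
          norm_num
          ring
  calc _ ≤ _ := measure_mono hsub
    _ ≤ ∑ S : Finset (Fin n), bipartiteBinomialRandom n p
          (⋃ T ∈ (Finset.univ : Finset (Finset (Fin n))), bad S T) :=
        measure_biUnion_finset_le _ _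
    _ ≤ ∑ S : Finset (Fin n), ∑ T : Finset (Fin n), bipartiteBinomialRandom n p (bad S T) :=
        Finset.sum_le_sum fun S _ => measure_biUnion_finset_le _ _
    _ ≤ ∑ S : Finset (Fin n), ∑ T : Finset (Fin n), ENNReal.ofReal (w S T) :=
        Finset.sum_le_sum fun S _ => Finset.sum_le_sum fun T _ => hbad S T
    _ = ENNReal.ofReal (∑ S : Finset (Fin n), ∑ T : Finset (Fin n), w S T) := by
        rw [ENNReal.ofReal_sum_of_nonneg fun S _ => Finset.sum_nonneg fun T _ => hw S T]
        exact Finset.sum_congr rfl fun S _ =>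
          (ENNReal.ofReal_sum_of_nonneg fun T _ => hw S T).symm
    _ ≤ _ := ENNReal.ofReal_le_ofReal hsum

theorem lemma3p3 (p : ℕ → unitInterval)
    (hp : ∀ᶠ n : ℕ in atTop, Real.log n ^ 10 / n ≤ (p n : ℝ) ∧ (p n : ℝ) ≤ 1 / 2) :
    Tendsto (fun n : ℕ => bipartiteBinomialRandom n (p n) {B | RobustlyRegular n (p n) B})
      atTop (𝓝 1) := by
  have hinv : Tendsto (fun n : ℕ => ENNReal.ofReal (2 * Real.exp 2 * (n : ℝ)⁻¹)) atTop (𝓝 0) := by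
    have := (tendsto_inv_atTop_nhds_zero_nat (𝕜 := ℝ)).const_mul (2 * Real.exp 2)
    simpa using ENNReal.tendsto_ofReal this
  have hlow : Tendsto (fun n : ℕ => 1 - ENNReal.ofReal (2 * Real.exp 2 * (n : ℝ)⁻¹)) atTop
      (𝓝 1) := by
    simpa using ENNReal.Tendsto.sub tendsto_const_nhds hinv (.inl ENNReal.one_ne_top)
  refine tendsto_of_tendsto_of_tendsto_of_le_of_le' hlow tendsto_const_nhds ?_
    (.of_forall fun n => prob_le_one)
  filter_upwards [hp, eventually_gt_atTop 0,
    (Real.tendsto_log_atTop.comp tendsto_natCast_atTop_atTop).eventually_ge_atTop 2]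
    with n hpn hn hlog
  have hlog : 2 ≤ Real.log n := hlog
  have hnp : Real.log n ^ 10 ≤ n * (p n : ℝ) := by
    rw [mul_comm, ← div_le_iff₀ (by exact_mod_cast hn)]
    exact hpn.1
  rw [tsub_le_iff_right]
  calc 1 = bipartiteBinomialRandom n (p n) Set.univ := measure_univ.symm
    _ ≤ bipartiteBinomialRandom n (p n) ({B | RobustlyRegular n (p n) B} ∪
          {B | ¬ IsLowerUniform n (p n) (1 / Real.log n ^ 2) B}) := by
        refine measure_mono fun B _ => ?_
        by_cases hB : IsLowerUniform n (p n) (1 / Real.log n ^ 2) B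
        · exact .inl (hB.robustlyRegular hlog hnp)
        · exact .inr hB
    _ ≤ _ := (measure_union_le _ _).trans
        (add_le_add_right (bipartiteBinomialRandom_not_isLowerUniform (p n) hlog hnp) _)
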